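/- Let $C,\xi\in\mathbb{R}$ with $C\neq 1$, let $k\in(0,1)$, and put $\omega=\sqrt{3|C-1|}$, $k'=\sqrt{1-k^2}$. Consider the linear differential equation over $\mathbb{C}(z)$ $$W''=r(z)\,W,\qquad r=-q+\tfrac12 p'+\tfrac14 p^2,\qquad '=\frac{d}{dz},$$ where $$p(z)=\frac{z\left(-1+2(k^2-z^2)\right)}{(k^2-z^2)(z^2+k'^2)},\qquad q(z)=\begin{cases}\dfrac{-\xi+(1+\omega z)^2+\omega^2(z^2+k'^2)}{\omega^2(k^2-z^2)(z^2+k'^2)} & \text{if } C<1,\\[3mm] \dfrac{-\xi+(1+\omega z)^2-\omega^2(k^2-z^2)}{\omega^2(k^2-z^2)(z^2+k'^2)} & \text{if } C>1.\end{cases}$$ Call this equation reducible if it has an exponential solution, that is, a solution (on some domain of $\mathbb{C}$ free of poles of $r$) of the form $W=\exp\int u$ with $u\in\mathbb{C}(z)$. Then the equation is not reducible, except in the case $$\xi=\tfrac32(1-C)\quad\text{and}\quad \omega^2=\frac{2}{2k^2-1},$$ in which it is reducible. -/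

import Mathlib

namespace SymmetricSatellite

noncomputable section

/-- The frequency `ω = √(3|C - 1|)`. -/
def omega (C : ℝ) : ℝ := Real.sqrt (3 * |C - 1|)

/-- The complementary modulus `k' = √(1 - k²)`. -/
def compl (k : ℝ) : ℝ := Real.sqrt (1 - k ^ 2)

/-- The coefficient `p(z)` of the normal variational equation `Q'' + p(z) Q' + q(z) Q = 0`. -/
def pCoeff (k : ℝ) (z : ℂ) : ℂ :=
  z * (-1 + 2 * ((k : ℂ) ^ 2 - z ^ 2)) /
    (((k : ℂ) ^ 2 - z ^ 2) * (z ^ 2 + (compl k : ℂ) ^ 2))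

/-- The coefficient `q(z)` of the normal variational equation `Q'' + p(z) Q' + q(z) Q = 0`
(used for `C ≠ 1` only). -/
def qCoeff (C k ξ : ℝ) (z : ℂ) : ℂ :=
  if C < 1 then
    (-(ξ : ℂ) + (1 + (omega C : ℂ) * z) ^ 2 + (omega C : ℂ) ^ 2 * (z ^ 2 + (compl k : ℂ) ^ 2)) /
      ((omega C : ℂ) ^ 2 * ((k : ℂ) ^ 2 - z ^ 2) * (z ^ 2 + (compl k : ℂ) ^ 2))
  else
    (-(ξ : ℂ) + (1 + (omega C : ℂ) * z) ^ 2 - (omega C : ℂ) ^ 2 * ((k : ℂ) ^ 2 - z ^ 2)) /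
      ((omega C : ℂ) ^ 2 * ((k : ℂ) ^ 2 - z ^ 2) * (z ^ 2 + (compl k : ℂ) ^ 2))

/-- The coefficient `r = -q + p'/2 + p²/4` of the reduced form `W'' = r(z) W`. -/
def rCoeff (C k ξ : ℝ) (z : ℂ) : ℂ :=
  -qCoeff C k ξ z + (1 / 2) * deriv (pCoeff k) z + (1 / 4) * pCoeff k z ^ 2

/-- `W` is an exponential solution of `W'' = r(z) W` on the domain `U ⊆ ℂ`, on which `r` is
holomorphic: it solves the equation there and `W = exp (∫ u)` for a rational function
`u = A / B ∈ ℂ(z)` without poles in `U`. The primitive `∫ u` is `Φ`. -/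
def IsExponentialSolution (r : ℂ → ℂ) (U : Set ℂ) (W : ℂ → ℂ) : Prop :=
  IsOpen U ∧ IsConnected U ∧ DifferentiableOn ℂ r U ∧
  (∀ z ∈ U, deriv (deriv W) z = r z * W z) ∧
  ∃ (A B : Polynomial ℂ) (Φ : ℂ → ℂ),
    ∀ z ∈ U, B.eval z ≠ 0 ∧ HasDerivAt Φ (A.eval z / B.eval z) z ∧ W z = Complex.exp (Φ z)

/-- The equation `W'' = r(z) W` is reducible: it has an exponential solution. Such solutions are
in general multivalued on the plane, so a branch on some domain is asked for. -/
def IsReducible (r : ℂ → ℂ) : Prop :=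
  ∃ (U : Set ℂ) (W : ℂ → ℂ), IsExponentialSolution r U W

end

end SymmetricSatellite

/-!
Write `P = (k² - z²)(z² + k'²)`. Then `p = P' / (2P)` and `q = N / P` with a quadratic
`N = 2z² + (2/ω)z + m`. If `W = exp ∫ u` solves `W'' = rW`, then `v = u - p/2` is a rational
solution of the Riccati equation `v' + v² + pv + q = 0`. With `v = A / B` in lowest terms this is
the polynomial identity `2P(A'B - AB' + A²) + P'AB + 2NB² = 0`.

Local analysis (`residue_of_riccati`): all poles of `v` are simple, with residue `1` off the zeros
of `P` and residue `1/2` at the zeros of `P`. At infinity `v` vanishes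
(`natDegree_lt_of_riccati`), so `v = D'/D + S'/(2S)`, where `D` and `S` are squarefree and
`S` divides `P` (`exists_finset_of_riccati`). Moreover `v ~ α/z` with
`(α - 1)(α + 2) = 0`. Since `α = deg D + (deg S)/2 ≥ 0`, it equals `1`, and only two shapes remain
(`card_of_riccati`):

* `v = 1/(z - a)`: comparing coefficients in `P' + 2(z - a)N = 0` gives `a = 1/ω`, `m = 0` and
  `2k² - 1 = 2/ω²`, which is the exceptional case (`params_of_linear`);
* `v = ½/(z - a) + ½/(z - b)` with distinct zeros `a`, `b` of `P`: the next coefficient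
  gives `a + b = 2/ω`, whereas a sum of two distinct zeros among `±k, ±ik'` is zero or not real.

Conversely, in the exceptional case `v = 1/(z - 1/ω)` solves the Riccati equation, and
`exp ∫ (v + p/2)` is an exponential solution on any disc free of poles.
-/

namespace SymmetricSatellite

open Polynomial

/-! ### The polynomial Riccati equation -/

/-- The Riccati equation `v' + v² + (P'/(2P)) v + N/P = 0` for `v = A / B`, with the denominators
cleared. -/
def PolyRiccati (P N A B : ℂ[X]) : Prop :=
  2 * P * (derivative A * B - A * derivative B + A ^ 2) + derivative P * A * B
    + 2 * N * B ^ 2 = 0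

/-- The poles of a rational solution `A / B` of the Riccati equation are simple; the residue
`A(a) / B'(a)` is `1/2` at the zeros of `P` and `1` elsewhere. -/
theorem residue_of_riccati {P N A B : ℂ[X]} (h : PolyRiccati P N A B) (hAB : IsCoprime A B)
    (hP : ∀ a, P.eval a = 0 → (derivative P).eval a ≠ 0) {a : ℂ} (ha : B.eval a = 0) :
    (derivative B).eval a ≠ 0 ∧
      (P.eval a ≠ 0 → A.eval a = (derivative B).eval a) ∧
      (P.eval a = 0 → 2 * A.eval a = (derivative B).eval a) := by
  have hA : A.eval a ≠ 0 := by
    intro h0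
    obtain ⟨u, v, huv⟩ := hAB
    have := congrArg (eval a) huv
    simp [h0, ha] at this
  have key : (P.eval a ≠ 0 → A.eval a = (derivative B).eval a) ∧
      (P.eval a = 0 → 2 * A.eval a = (derivative B).eval a) := by
    refine ⟨fun hPa => ?_, fun hPa => ?_⟩
    · have := congrArg (eval a) h
      simp only [eval_add, eval_mul, eval_sub, eval_pow, ha, eval_ofNat, eval_zero] at this
      have h2 : (2 * P.eval a * A.eval a) * (A.eval a - (derivative B).eval a) = 0 := by
        linear_combination this
      have := (mul_eq_zero.mp h2).resolve_left (by simp [hA, hPa])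
      linear_combination this
    · have hP' := hP a hPa
      obtain ⟨P₁, rfl⟩ := dvd_iff_isRoot.mpr hPa
      obtain ⟨B₁, rfl⟩ := dvd_iff_isRoot.mpr ha
      -- Here the identity vanishes at `a` trivially; it is divided by `X - a` first.
      have h1 : 2 * P₁ * (derivative A * ((X - C a) * B₁) - A * derivative ((X - C a) * B₁)
          + A ^ 2) + derivative ((X - C a) * P₁) * A * B₁
          + 2 * N * ((X - C a) * B₁ ^ 2) = 0 := by
        apply mul_left_cancel₀ (X_sub_C_ne_zero a)
        rw [mul_zero, ← h]
        ring
      have := congrArg (eval a) h1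
      simp only [derivative_mul, derivative_sub, derivative_X, derivative_C, eval_add, eval_mul,
        eval_sub, eval_pow, eval_ofNat, eval_zero, eval_X, eval_C, sub_self, zero_mul, mul_zero,
        sub_zero, one_mul, add_zero, zero_sub] at this hP' ⊢
      have h2 : (P₁.eval a * A.eval a) * (2 * A.eval a - B₁.eval a) = 0 := by
        linear_combination this
      have := (mul_eq_zero.mp h2).resolve_left (by simp [hA, hP'])
      linear_combination this
  refine ⟨fun h0 => hA ?_, key⟩
  rw [h0] at key
  by_cases hPa : P.eval a = 0
  · simpa using key.2 hPa
  · exact key.1 hPa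

theorem natDegree_X_mul_derivative_le {Q : ℂ[X]} {n : ℕ} (h : Q.natDegree ≤ n) :
    (X * derivative Q).natDegree ≤ n := by
  rw [natDegree_le_iff_coeff_eq_zero]
  rintro (_ | m) hm
  · omega
  · rw [coeff_X_mul, coeff_derivative, coeff_eq_zero_of_natDegree_lt (by omega), zero_mul]

theorem coeff_X_mul_derivative (Q : ℂ[X]) (n : ℕ) :
    (X * derivative Q).coeff n = n * Q.coeff n := by
  rcases n with _ | m
  · simp
  · rw [coeff_X_mul, coeff_derivative]
    push_cast
    ring

/-- A rational solution of the Riccati equation vanishes at infinity: otherwise the term `v²`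
would dominate. -/
theorem natDegree_lt_of_riccati {P N A B : ℂ[X]} (h : PolyRiccati P N A B)
    (hP : P.natDegree ≤ 4) (hP4 : P.coeff 4 = -1) (hN : N.natDegree ≤ 2) (hB : B ≠ 0) :
    A.degree < B.degree := by
  by_contra hlt
  have hA : A ≠ 0 := by
    rintro rfl
    exact hlt (by simpa using bot_lt_iff_ne_bot.mpr (degree_ne_bot.mpr hB))
  have hBA : B.natDegree ≤ A.natDegree := natDegree_le_natDegree (not_lt.mp hlt)
  set a := A.natDegree with ha
  have hA' := natDegree_X_mul_derivative_le ha.ge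
  have hB' := natDegree_X_mul_derivative_le hBA
  have hP' := natDegree_X_mul_derivative_le hP
  have hAA : (A * A).natDegree ≤ a + a := natDegree_mul_le_of_le le_rfl le_rfl
  have hmain : (P * (A * A)).coeff (4 + (a + a)) = -(A.leadingCoeff * A.leadingCoeff) := by
    rw [coeff_mul_add_eq_of_natDegree_le hP hAA,
      coeff_mul_add_eq_of_natDegree_le le_rfl le_rfl, hP4]
    rw [coeff_natDegree, neg_one_mul]
  have hrest : (2 * (P * (X * derivative A * B - A * (X * derivative B)))
      + X * derivative P * (A * B) + 2 * (X * N * (B * B))).natDegree ≤ 4 + (a + a) := by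
    have e2 : (2 : ℂ[X]).natDegree ≤ 0 := (natDegree_ofNat 2).le
    refine natDegree_add_le_of_degree_le (natDegree_add_le_of_degree_le ?_ ?_) ?_
    · refine (natDegree_mul_le_of_le e2 (natDegree_mul_le_of_le hP
        (natDegree_sub_le_of_le (natDegree_mul_le_of_le hA' hBA)
          (natDegree_mul_le_of_le le_rfl hB')))).trans (by omega)
    · exact natDegree_mul_le_of_le hP' (natDegree_mul_le_of_le le_rfl hBA)
    · refine (natDegree_mul_le_of_le e2 (natDegree_mul_le_of_le
        (natDegree_mul_le_of_le natDegree_X_le hN)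
        (natDegree_mul_le_of_le hBA hBA))).trans (by omega)
  have hX : X * (C 2 * (P * (A * A))) + (2 * (P * (X * derivative A * B - A * (X * derivative B)))
      + X * derivative P * (A * B) + 2 * (X * N * (B * B))) = 0 := by
    unfold PolyRiccati at h
    simp only [map_ofNat]
    linear_combination X * h
  have := congrArg (fun Q : ℂ[X] => Q.coeff (4 + (a + a) + 1)) hX
  simp only [coeff_add _ _ (4 + (a + a) + 1), coeff_X_mul, coeff_C_mul, hmain, coeff_zero] at this
  rw [← coeff_add, ← coeff_add, coeff_eq_zero_of_natDegree_lt (by omega)] at this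
  have h0 : A.leadingCoeff * A.leadingCoeff = 0 := by linear_combination (-1 / 2) * this
  exact hA (by simpa using h0)

/-- The leading coefficient `α` of a rational solution `A / B ~ α / z` at infinity is an exponent
of the linear equation there, so `α = 1` or `α = -2`. -/
theorem leading_of_riccati {P N A B : ℂ[X]} (h : PolyRiccati P N A B)
    (hP : P.natDegree ≤ 4) (hP4 : P.coeff 4 = -1) (hN : N.natDegree ≤ 2) (hN2 : N.coeff 2 = 2)
    {b : ℕ} (hA : (X * A).natDegree ≤ b) (hB : B.natDegree ≤ b) (hBb : B.coeff b = 1) :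
    ((X * A).coeff b - 1) * ((X * A).coeff b + 2) = 0 := by
  have hA' := natDegree_X_mul_derivative_le hA
  have hB' := natDegree_X_mul_derivative_le hB
  have hP' := natDegree_X_mul_derivative_le hP
  have hX : C 2 * (P * (X * derivative (X * A) * B - (X * A) * B - (X * A) * (X * derivative B)
      + (X * A) * (X * A))) + X * derivative P * ((X * A) * B)
      + C 2 * ((X ^ 2 * N) * (B * B)) = 0 := by
    unfold PolyRiccati at h
    simp only [map_ofNat, derivative_mul, derivative_X]
    linear_combination X ^ 2 * h
  have hX2 : (X ^ 2 * N).natDegree ≤ 4 :=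
    (natDegree_mul_le_of_le (natDegree_X_pow_le 2) hN).trans (by norm_num)
  have hX2c : (X ^ 2 * N).coeff 4 = 2 := by
    rw [show (4 : ℕ) = 2 + 2 from rfl, coeff_X_pow_mul, hN2]
  have hm {F G : ℂ[X]} (hF : F.natDegree ≤ b) (hG : G.natDegree ≤ b) :
      (F * G).natDegree ≤ b + b := natDegree_mul_le_of_le hF hG
  have := congrArg (fun Q : ℂ[X] => Q.coeff (4 + (b + b))) hX
  simp only [coeff_add _ _ (4 + (b + b)), coeff_C_mul] at this
  have hsum : (X * derivative (X * A) * B - X * A * B - X * A * (X * derivative B)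
      + X * A * (X * A)).natDegree ≤ b + b :=
    natDegree_add_le_of_degree_le ((natDegree_sub_le_of_le (natDegree_sub_le_of_le (hm hA' hB)
      (hm hA hB)) (hm hA hB')).trans (by simp)) (hm hA hA)
  rw [coeff_mul_add_eq_of_natDegree_le hP hsum,
    coeff_mul_add_eq_of_natDegree_le hP' (hm hA hB),
    coeff_mul_add_eq_of_natDegree_le hX2 (hm hB hB), coeff_add, coeff_sub, coeff_sub,
    coeff_mul_add_eq_of_natDegree_le hA' hB, coeff_mul_add_eq_of_natDegree_le hA hB,
    coeff_mul_add_eq_of_natDegree_le hA hB', coeff_mul_add_eq_of_natDegree_le hA hA,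
    coeff_mul_add_eq_of_natDegree_le hB hB, coeff_X_mul_derivative, coeff_X_mul_derivative,
    coeff_X_mul_derivative, hP4, hX2c, hBb, coeff_zero] at this
  push_cast at this
  linear_combination (-1 / 2) * this

/-! ### Rational solutions of the Riccati equation -/

/-- The monic polynomial with simple zeros exactly at the points of `s`. -/
noncomputable def rootPoly (s : Finset ℂ) : ℂ[X] := ∏ a ∈ s, (X - C a)

theorem rootPoly_monic (s : Finset ℂ) : (rootPoly s).Monic := monic_prod_X_sub_C _ _

theorem natDegree_rootPoly (s : Finset ℂ) : (rootPoly s).natDegree = s.card :=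
  natDegree_finsetProd_X_sub_C_eq_card s fun a => a

theorem eval_rootPoly_of_mem {s : Finset ℂ} {a : ℂ} (h : a ∈ s) : (rootPoly s).eval a = 0 := by
  rw [rootPoly, eval_prod]
  exact Finset.prod_eq_zero h (by simp)

/-- A rational solution of the Riccati equation in lowest terms is `D'/D + S'/(2S)` for squarefree
`D` and `S`, where the zeros of `S` are zeros of `P`. -/
theorem exists_finset_of_riccati {P N A B : ℂ[X]} (h : PolyRiccati P N A B)
    (hAB : IsCoprime A B) (hB : B.Monic) (hdeg : A.degree < B.degree)
    (hP : ∀ a, P.eval a = 0 → (derivative P).eval a ≠ 0) :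
    ∃ d s : Finset ℂ, (∀ a ∈ s, P.eval a = 0) ∧ B = rootPoly d * rootPoly s ∧
      2 * A = 2 * derivative (rootPoly d) * rootPoly s
        + rootPoly d * derivative (rootPoly s) := by
  classical
  set R := B.roots.toFinset with hR
  have hnodup : B.roots.Nodup := by
    rw [Multiset.nodup_iff_count_le_one]
    intro a
    rw [count_roots]
    by_contra hlt
    obtain ⟨h1, h2⟩ := (one_lt_rootMultiplicity_iff_isRoot hB.ne_zero).mp (not_le.mp hlt)
    exact (residue_of_riccati h hAB hP h1).1 h2
  have hBR : B = rootPoly R := by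
    conv_lhs => rw [(IsAlgClosed.splits B).eq_prod_roots_of_monic hB]
    rw [rootPoly, Finset.prod, hR, Multiset.toFinset_val, hnodup.dedup]
  set d := R.filter fun a => ¬ P.eval a = 0 with hd
  set s := R.filter fun a => P.eval a = 0 with hs
  have hds : B = rootPoly d * rootPoly s := by
    rw [hBR, rootPoly, rootPoly, rootPoly, mul_comm, hs, hd, Finset.prod_filter_mul_prod_filter_not]
  refine ⟨d, s, fun a ha => (Finset.mem_filter.mp ha).2, hds, ?_⟩
  rw [← sub_eq_zero]
  have hcard : B.degree = R.card := by
    rw [degree_eq_natDegree hB.ne_zero, hBR, natDegree_rootPoly]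
  have hder : ∀ t : Finset ℂ, (derivative (rootPoly t)).degree < (rootPoly t).degree :=
    fun t => degree_derivative_lt (rootPoly_monic t).ne_zero
  have hd0 : (rootPoly d).degree ≠ ⊥ := degree_ne_bot.mpr (rootPoly_monic d).ne_zero
  have hs0 : (rootPoly s).degree ≠ ⊥ := degree_ne_bot.mpr (rootPoly_monic s).ne_zero
  -- Both sides have degree less than `deg B` and the same values at the zeros of `B`.
  refine eq_zero_of_degree_lt_of_eval_finset_eq_zero R ?_ ?_
  · rw [← hcard]
    have e2 : ∀ Q : ℂ[X], (2 * Q).degree = Q.degree := fun Q => by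
      rw [← map_ofNat C, degree_C_mul two_ne_zero]
    refine (degree_sub_le _ _).trans_lt (max_lt ?_ ((degree_add_le _ _).trans_lt (max_lt ?_ ?_)))
    · rwa [e2]
    · rw [mul_assoc, e2, hds, degree_mul, degree_mul]
      exact WithBot.add_lt_add_right hs0 (hder d)
    · rw [hds, degree_mul, degree_mul]
      exact WithBot.add_lt_add_left hd0 (hder s)
  · intro a ha
    have hBa : B.eval a = 0 := by rw [hBR]; exact eval_rootPoly_of_mem ha
    obtain ⟨-, h1, h2⟩ := residue_of_riccati h hAB hP hBa
    have hB' : (derivative B).eval a = (derivative (rootPoly d)).eval a * (rootPoly s).eval a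
        + (rootPoly d).eval a * (derivative (rootPoly s)).eval a := by
      rw [hds, derivative_mul, eval_add, eval_mul, eval_mul]
    simp only [eval_sub, eval_add, eval_mul, eval_ofNat]
    by_cases hPa : P.eval a = 0
    · have h0 := eval_rootPoly_of_mem (Finset.mem_filter.mpr ⟨ha, hPa⟩ : a ∈ s)
      rw [h2 hPa, hB', h0]
      ring
    · have h0 := eval_rootPoly_of_mem (Finset.mem_filter.mpr ⟨ha, hPa⟩ : a ∈ d)
      rw [h1 hPa, hB', h0]
      ring

/-- The residue count: `deg D + (deg S)/2` is the exponent `1` at infinity. -/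
theorem card_of_riccati {P N A : ℂ[X]} {d s : Finset ℂ}
    (h : PolyRiccati P N A (rootPoly d * rootPoly s))
    (hP : P.natDegree ≤ 4) (hP4 : P.coeff 4 = -1) (hN : N.natDegree ≤ 2) (hN2 : N.coeff 2 = 2)
    (hA : 2 * A = 2 * derivative (rootPoly d) * rootPoly s
        + rootPoly d * derivative (rootPoly s)) :
    (d.card = 1 ∧ s.card = 0) ∨ (d.card = 0 ∧ s.card = 2) := by
  have hd := (natDegree_rootPoly d).le
  have hs := (natDegree_rootPoly s).le
  have hd1 : (rootPoly d).coeff d.card = 1 := by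
    rw [← natDegree_rootPoly]; exact rootPoly_monic d
  have hs1 : (rootPoly s).coeff s.card = 1 := by
    rw [← natDegree_rootPoly]; exact rootPoly_monic s
  have hd' := natDegree_X_mul_derivative_le hd
  have hs' := natDegree_X_mul_derivative_le hs
  have hXA : X * A = X * derivative (rootPoly d) * rootPoly s
      + C (1 / 2) * (rootPoly d * (X * derivative (rootPoly s))) := by
    have h2 : (C (1 / 2) : ℂ[X]) * 2 = 1 := by
      rw [← map_ofNat C, ← C_mul]
      norm_num
    linear_combination X * C (1 / 2) * hA
      + (X * derivative (rootPoly d) * rootPoly s - X * A) * h2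
  have hdeg : (X * A).natDegree ≤ d.card + s.card := by
    rw [hXA]
    exact natDegree_add_le_of_degree_le (natDegree_mul_le_of_le hd' hs)
      ((natDegree_C_mul_le _ _).trans (natDegree_mul_le_of_le hd hs'))
  have hco : (X * A).coeff (d.card + s.card) = (d.card + s.card / 2 : ℂ) := by
    rw [hXA, coeff_add, coeff_C_mul, coeff_mul_add_eq_of_natDegree_le hd' hs,
      coeff_mul_add_eq_of_natDegree_le hd hs', coeff_X_mul_derivative, coeff_X_mul_derivative,
      hd1, hs1]
    ring
  have := leading_of_riccati h hP hP4 hN hN2 hdeg (natDegree_mul_le_of_le hd hs)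
    (by rw [coeff_mul_add_eq_of_natDegree_le hd hs, hd1, hs1, one_mul])
  rw [hco] at this
  have hsum : 2 * d.card + s.card = 2 := by
    rcases mul_eq_zero.mp this with h1 | h1
    · have : (2 * d.card + s.card : ℂ) = 2 := by linear_combination 2 * h1
      exact_mod_cast this
    · have : (2 * d.card + s.card + 4 : ℂ) = 0 := by linear_combination 2 * h1
      have h4 : 2 * d.card + s.card + 4 = 0 := by exact_mod_cast this
      omega
  omega

/-! ### The normal variational equation -/

/-- The polynomial `P = (k² - z²)(z² + k'²)`, for which `p = P' / (2P)`. -/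
noncomputable def quartic (k : ℝ) : ℂ[X] :=
  (C ((k : ℂ) ^ 2) - X ^ 2) * (X ^ 2 + C ((compl k : ℂ) ^ 2))

/-- The constant term of the numerator `N = q P`. -/
noncomputable def shift (C k ξ : ℝ) : ℝ :=
  (1 - ξ) / omega C ^ 2 + if C < 1 then compl k ^ 2 else -k ^ 2

/-- The polynomial `N = 2z² + (2/ω)z + m`, for which `q = N / P`. -/
noncomputable def numer (ω m : ℝ) : ℂ[X] :=
  C 2 * X ^ 2 + C (2 / ω : ℂ) * X + C (m : ℂ)

theorem omega_pos {C : ℝ} (hC : C ≠ 1) : 0 < omega C :=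
  Real.sqrt_pos.mpr (mul_pos three_pos (abs_pos.mpr (sub_ne_zero.mpr hC)))

theorem omega_sq (C : ℝ) : omega C ^ 2 = 3 * |C - 1| :=
  Real.sq_sqrt (by positivity)

theorem compl_pos {k : ℝ} (hk : k ∈ Set.Ioo (0 : ℝ) 1) : 0 < compl k :=
  Real.sqrt_pos.mpr (by nlinarith [hk.1, hk.2])

theorem compl_sq {k : ℝ} (hk : k ∈ Set.Ioo (0 : ℝ) 1) : compl k ^ 2 = 1 - k ^ 2 :=
  Real.sq_sqrt (by nlinarith [hk.1, hk.2])

theorem ofReal_compl_sq {k : ℝ} (hk : k ∈ Set.Ioo (0 : ℝ) 1) :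
    (compl k : ℂ) ^ 2 = 1 - (k : ℂ) ^ 2 := by
  exact_mod_cast compl_sq hk

theorem eval_quartic (k : ℝ) (z : ℂ) :
    (quartic k).eval z = ((k : ℂ) ^ 2 - z ^ 2) * (z ^ 2 + (compl k : ℂ) ^ 2) := by
  simp [quartic]

theorem eval_derivative_quartic {k : ℝ} (hk : k ∈ Set.Ioo (0 : ℝ) 1) (z : ℂ) :
    (derivative (quartic k)).eval z = 2 * (z * (-1 + 2 * ((k : ℂ) ^ 2 - z ^ 2))) := by
  rw [quartic, ofReal_compl_sq hk]
  simp only [derivative_mul, derivative_sub, derivative_add, derivative_C, derivative_X_pow,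
    eval_add, eval_sub, eval_mul, eval_C, eval_X, eval_pow, eval_zero, Nat.cast_ofNat]
  ring

theorem eval_numer (ω m : ℝ) (z : ℂ) :
    (numer ω m).eval z = 2 * z ^ 2 + 2 / ω * z + m := by
  simp [numer]

theorem quartic_roots_simple {k : ℝ} (hk : k ∈ Set.Ioo (0 : ℝ) 1) (a : ℂ)
    (h : (quartic k).eval a = 0) : (derivative (quartic k)).eval a ≠ 0 := by
  have hk0 : (k : ℂ) ≠ 0 := by exact_mod_cast hk.1.ne'
  have hc0 : (compl k : ℂ) ≠ 0 := by exact_mod_cast (compl_pos hk).ne'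
  have hc := ofReal_compl_sq hk
  rw [eval_quartic] at h
  rw [eval_derivative_quartic hk]
  rcases mul_eq_zero.mp h with h1 | h1
  · have ha : a ≠ 0 := by
      rintro rfl
      simp [hk0] at h1
    rw [h1]
    simp [ha]
  · have ha : a ≠ 0 := by
      rintro rfl
      simp [hc0] at h1
    have : -1 + 2 * ((k : ℂ) ^ 2 - a ^ 2) = 1 := by linear_combination 2 * hc - 2 * h1
    rw [this]
    simp [ha]

theorem quartic_ne_zero {k : ℝ} (hk : k ∈ Set.Ioo (0 : ℝ) 1) : quartic k ≠ 0 := by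
  intro h
  have := quartic_roots_simple hk 0
  simp [h] at this

theorem quartic_eq (k : ℝ) : quartic k = C (-1) * X ^ 4
    + C ((k : ℂ) ^ 2 - (compl k : ℂ) ^ 2) * X ^ 2 + C ((k : ℂ) ^ 2 * (compl k : ℂ) ^ 2) := by
  simp only [quartic, C_sub, C_mul, C_neg, C_1]
  ring

theorem natDegree_quartic_le (k : ℝ) : (quartic k).natDegree ≤ 4 := by
  rw [quartic_eq]
  compute_degree

theorem coeff_quartic (k : ℝ) : (quartic k).coeff 4 = -1 := by
  rw [quartic_eq]
  simp only [coeff_add, coeff_C_mul, coeff_X_pow, coeff_C]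
  norm_num

theorem natDegree_numer_le (ω m : ℝ) : (numer ω m).natDegree ≤ 2 := by
  rw [numer]
  compute_degree

theorem coeff_numer (ω m : ℝ) : (numer ω m).coeff 2 = 2 := by
  rw [numer]
  simp only [coeff_add, coeff_C_mul, coeff_X_pow, coeff_X, coeff_C]
  norm_num

theorem pCoeff_eq {k : ℝ} (hk : k ∈ Set.Ioo (0 : ℝ) 1) (z : ℂ) :
    pCoeff k z = (derivative (quartic k)).eval z / (2 * (quartic k).eval z) := by
  rw [pCoeff, eval_derivative_quartic hk, eval_quartic, mul_div_mul_left _ _ two_ne_zero]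

theorem qCoeff_eq {C : ℝ} (hC : C ≠ 1) (k ξ : ℝ) (z : ℂ) :
    qCoeff C k ξ z = (numer (omega C) (shift C k ξ)).eval z / (quartic k).eval z := by
  have hω : (omega C : ℂ) ≠ 0 := by exact_mod_cast (omega_pos hC).ne'
  have hω2 : (omega C : ℂ) ^ 2 ≠ 0 := pow_ne_zero 2 hω
  rw [eval_numer, eval_quartic, ← mul_div_mul_left _ _ hω2, qCoeff, shift]
  split_ifs
  all_goals
    rw [mul_assoc]
    congr 1
    push_cast
    field_simp
    ring

/-- The exceptional case in terms of `P` and `N`: the constant term `m` of `N` vanishes and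
`2k² - 1 = 2/ω²`. The sign of `C - 1` no longer appears. -/
theorem exceptional_iff {C k : ℝ} (ξ : ℝ) (hC : C ≠ 1) (hk : k ∈ Set.Ioo (0 : ℝ) 1) :
    (ξ = 3 / 2 * (1 - C) ∧ omega C ^ 2 = 2 / (2 * k ^ 2 - 1)) ↔
      (shift C k ξ = 0 ∧ (2 * k ^ 2 - 1) * omega C ^ 2 = 2) := by
  have hω2 : omega C ^ 2 ≠ 0 := pow_ne_zero 2 (omega_pos hC).ne'
  have h2 : omega C ^ 2 = 2 / (2 * k ^ 2 - 1) ↔ (2 * k ^ 2 - 1) * omega C ^ 2 = 2 := by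
    constructor
    · intro h
      -- If `2k² = 1`, the quotient is the junk value `0`, which `ω² > 0` excludes.
      have h0 : 2 * k ^ 2 - 1 ≠ 0 := by
        intro h0
        rw [h0, div_zero] at h
        exact hω2 h
      rw [h]
      field_simp
    · intro h
      have h0 : 2 * k ^ 2 - 1 ≠ 0 := by
        intro h0
        rw [h0, zero_mul] at h
        norm_num at h
      rw [eq_div_iff h0]
      linarith
  rw [h2]
  refine and_congr_left fun h => ?_
  have h3 := omega_sq C
  rw [shift, compl_sq hk]
  split_ifs with hlt
  · rw [abs_of_neg (by linarith)] at h3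
    rw [div_add' _ _ _ hω2, div_eq_zero_iff, or_iff_left hω2]
    constructor <;> intro h <;> nlinarith
  · rw [abs_of_nonneg (by linarith)] at h3
    rw [div_add' _ _ _ hω2, div_eq_zero_iff, or_iff_left hω2]
    constructor <;> intro h <;> nlinarith

/-- The shape `v = 1 / (z - a)` forces the parameters to be exceptional. -/
theorem params_of_linear {k ω m : ℝ} {a : ℂ} (hω : ω ≠ 0) (hk : k ∈ Set.Ioo (0 : ℝ) 1)
    (h : PolyRiccati (quartic k) (numer ω m) 1 (X - C a)) :
    m = 0 ∧ (2 * k ^ 2 - 1) * ω ^ 2 = 2 := by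
  have hωC : (ω : ℂ) ≠ 0 := by exact_mod_cast hω
  have h1 : (X - C a) * (derivative (quartic k) + 2 * numer ω m * (X - C a)) = 0 := by
    unfold PolyRiccati at h
    simp only [derivative_one, derivative_sub, derivative_X, derivative_C] at h
    linear_combination h
  have h2 := (mul_eq_zero.mp h1).resolve_left (X_sub_C_ne_zero a)
  have hz (z : ℂ) : z * (-1 + 2 * ((k : ℂ) ^ 2 - z ^ 2))
      + (2 * z ^ 2 + 2 / ω * z + m) * (z - a) = 0 := by
    have := congrArg (eval z) h2
    simp only [eval_add, eval_mul, eval_derivative_quartic hk, eval_numer, eval_ofNat, eval_sub,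
      eval_X, eval_C, eval_zero] at this
    linear_combination this / 2
  have c0 := hz 0
  have c1 := hz 1
  have c2 := hz (-1)
  have ha : a = 1 / ω := by linear_combination (-1 / 4) * (c1 + c2 - 2 * c0)
  subst ha
  have hm : (m : ℂ) = 0 := by
    have : (m : ℂ) * (1 / ω) = 0 := by linear_combination -c0
    simpa [hωC] using this
  refine ⟨by exact_mod_cast hm, ?_⟩
  rw [hm] at c1 c2
  have : (2 * (k : ℂ) ^ 2 - 1) = 2 / (ω : ℂ) ^ 2 := by
    linear_combination (c1 - c2) / 2
  have : (2 * (k : ℂ) ^ 2 - 1) * (ω : ℂ) ^ 2 = 2 := by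
    rw [this]
    field_simp
  exact_mod_cast this

/-- A sum of two distinct elements of `{±k, ±ik'}` is zero or not real. -/
theorem sum_roots_ne {k t : ℝ} (hk : k ∈ Set.Ioo (0 : ℝ) 1) (ht : t ≠ 0) {a b : ℂ} (hab : a ≠ b)
    (ha : (quartic k).eval a = 0) (hb : (quartic k).eval b = 0) : a + b ≠ t := by
  have hc := compl_pos hk
  have roots {z : ℂ} (hz : (quartic k).eval z = 0) :
      (z.re ^ 2 = k ^ 2 ∧ z.im = 0) ∨ (z.re = 0 ∧ z.im ^ 2 = compl k ^ 2) := by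
    rw [eval_quartic] at hz
    rcases mul_eq_zero.mp hz with h | h
    · left
      have : (z - k) * (z + k) = 0 := by linear_combination -h
      rcases mul_eq_zero.mp this with h | h
      · rw [sub_eq_zero.mp h]; simp
      · rw [eq_neg_of_add_eq_zero_left h]; simp
    · right
      have : (z - compl k * Complex.I) * (z + compl k * Complex.I) = 0 := by
        linear_combination h - (compl k : ℂ) ^ 2 * Complex.I_sq
      rcases mul_eq_zero.mp this with h | h
      · rw [sub_eq_zero.mp h]; simp
      · rw [eq_neg_of_add_eq_zero_left h]; simp
  intro hsum
  have hre : a.re + b.re = t := by simpa using congrArg Complex.re hsum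
  have him : a.im + b.im = 0 := by simpa using congrArg Complex.im hsum
  rcases roots ha with ⟨ha1, ha2⟩ | ⟨ha1, ha2⟩ <;> rcases roots hb with ⟨hb1, hb2⟩ | ⟨hb1, hb2⟩
  · rcases sq_eq_sq_iff_eq_or_eq_neg.mp (ha1.trans hb1.symm) with h | h
    · exact hab (Complex.ext h (ha2.trans hb2.symm))
    · exact ht (by linarith)
  · rw [show b.im = 0 by linarith] at hb2
    nlinarith
  · rw [show a.im = 0 by linarith] at ha2
    nlinarith
  · exact ht (by linarith)

/-- The shape `v = ½/(z - a) + ½/(z - b)` forces `a + b = 2/ω`. -/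
theorem sum_of_quadratic {k ω m : ℝ} {a b : ℂ} (hk : k ∈ Set.Ioo (0 : ℝ) 1) {A : ℂ[X]}
    (hA : 2 * A = X - C a + (X - C b))
    (h : PolyRiccati (quartic k) (numer ω m) A ((X - C a) * (X - C b))) :
    a + b = 2 / ω := by
  have hA2 : derivative A = 1 := by
    have h2 := congrArg derivative hA
    simp only [derivative_mul, derivative_ofNat, derivative_add, derivative_sub, derivative_X,
      derivative_C] at h2
    have : (2 : ℂ[X]) * (derivative A - 1) = 0 := by linear_combination h2
    exact sub_eq_zero.mp ((mul_eq_zero.mp this).resolve_left two_ne_zero)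
  unfold PolyRiccati at h
  rw [hA2] at h
  have hz (z : ℂ) : ((k : ℂ) ^ 2 - z ^ 2) * (z ^ 2 + (1 - (k : ℂ) ^ 2))
        * (2 * (z - a) * (z - b) - (2 * z - a - b) ^ 2 / 2)
      + (z * (-1 + 2 * ((k : ℂ) ^ 2 - z ^ 2))) * (2 * z - a - b) * ((z - a) * (z - b))
      + 2 * (2 * z ^ 2 + 2 / ω * z + m) * ((z - a) * (z - b)) ^ 2 = 0 := by
    have hAz := congrArg (eval z) hA
    have := congrArg (eval z) h
    simp only [eval_add, eval_mul, eval_sub, eval_pow, eval_ofNat, eval_X, eval_C, eval_zero,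
      eval_one, derivative_mul, derivative_sub, derivative_X, derivative_C,
      eval_derivative_quartic hk, eval_numer, eval_quartic, ofReal_compl_sq hk] at this hAz
    have hAz' : A.eval z = (2 * z - a - b) / 2 := by linear_combination hAz / 2
    rw [hAz'] at this
    linear_combination this
  -- The fifth difference isolates the coefficient of `z⁵`, since that of `z⁶` vanishes.
  linear_combination (-1 / 240) * (hz 3 - 5 * hz 2 + 10 * hz 1 - 10 * hz 0 + 5 * hz (-1)
    - hz (-2))

/-! ### From exponential solutions to the Riccati equation and back -/

theorem exists_coprime_quotient (F G : ℂ[X]) (hG : G ≠ 0) :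
    ∃ A B : ℂ[X], IsCoprime A B ∧ B.Monic ∧ A * G = F * B := by
  let x : RatFunc ℂ := algebraMap _ _ F / algebraMap _ _ G
  exact ⟨x.num, x.denom, x.isCoprime_num_denom, x.monic_denom,
    (RatFunc.num_mul_eq_mul_denom_iff hG).mpr rfl⟩

theorem hasDerivAt_eval_div (A B : ℂ[X]) {z : ℂ} (h : B.eval z ≠ 0) :
    HasDerivAt (fun w => A.eval w / B.eval w)
      (((derivative A).eval z * B.eval z - A.eval z * (derivative B).eval z) / B.eval z ^ 2) z :=
  (A.hasDerivAt z).div (B.hasDerivAt z) h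

/-- `p` is differentiable where `P` does not vanish. -/
theorem hasDerivAt_pCoeff {k : ℝ} (hk : k ∈ Set.Ioo (0 : ℝ) 1) {z : ℂ}
    (h : (quartic k).eval z ≠ 0) : HasDerivAt (pCoeff k) (deriv (pCoeff k) z) z := by
  rw [funext (pCoeff_eq hk)]
  exact (DifferentiableAt.div (derivative (quartic k)).differentiableAt
    ((quartic k).differentiableAt.const_mul 2) (mul_ne_zero two_ne_zero h)).hasDerivAt

theorem isOpen_eval_ne_zero (Q : ℂ[X]) : IsOpen {z : ℂ | Q.eval z ≠ 0} :=
  isOpen_ne_fun Q.continuous continuous_const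

/-- If `W = exp Φ` with `Φ' = u` on an open set, then `W'' = (u' + u²) W` there. -/
theorem deriv_deriv_of_exp {U : Set ℂ} (hU : IsOpen U) {W Φ u : ℂ → ℂ} {u' z : ℂ}
    (hΦ : ∀ w ∈ U, HasDerivAt Φ (u w) w) (hW : ∀ w ∈ U, W w = Complex.exp (Φ w)) (hz : z ∈ U)
    (hu : HasDerivAt u u' z) : deriv (deriv W) z = (u' + u z ^ 2) * W z := by
  have hW1 : ∀ w ∈ U, HasDerivAt W (u w * W w) w := by
    intro w hw
    have h1 := (hΦ w hw).cexp
    rw [← hW w hw, mul_comm] at h1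
    exact h1.congr_of_eventuallyEq (Filter.eventuallyEq_of_mem (hU.mem_nhds hw) hW)
  have h2 : deriv W =ᶠ[nhds z] fun w => u w * W w :=
    Filter.eventuallyEq_of_mem (hU.mem_nhds hz) fun w hw => (hW1 w hw).deriv
  rw [h2.deriv_eq, (hu.fun_mul (hW1 z hz)).deriv]
  ring

/-- An exponential solution yields a solution of the polynomial Riccati equation in lowest
terms. -/
theorem exists_riccati_of_isReducible {C k ξ : ℝ} (hC : C ≠ 1) (hk : k ∈ Set.Ioo (0 : ℝ) 1)
    (h : IsReducible (rCoeff C k ξ)) :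
    ∃ A B : ℂ[X], IsCoprime A B ∧ B.Monic ∧
      PolyRiccati (quartic k) (numer (omega C) (shift C k ξ)) A B := by
  obtain ⟨U, W, hUo, hUc, -, hode, A₀, B₀, Φ, hΦ⟩ := h
  obtain ⟨z₀, hz₀⟩ := hUc.nonempty
  have hB₀ : B₀ ≠ 0 := by
    rintro rfl
    exact (hΦ z₀ hz₀).1 (by simp)
  set P := quartic k with hPdef
  have hP0 : P ≠ 0 := quartic_ne_zero hk
  -- `A / B = u - p / 2`
  obtain ⟨A, B, hAB, hB, hquot⟩ := exists_coprime_quotient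
    (4 * P * A₀ - derivative P * B₀) (4 * P * B₀)
    (mul_ne_zero (mul_ne_zero (by norm_num) hP0) hB₀)
  refine ⟨A, B, hAB, hB, ?_⟩
  have hquot' (z : ℂ) : A.eval z * (4 * P.eval z * B₀.eval z)
      = (4 * P.eval z * A₀.eval z - (derivative P).eval z * B₀.eval z) * B.eval z := by
    simpa using congrArg (eval z) hquot
  have hBz {z : ℂ} (hz : z ∈ U) (hPz : P.eval z ≠ 0) : B.eval z ≠ 0 := by
    intro h0
    have h1 := hquot' z
    rw [h0, mul_zero] at h1
    have hA0 := (mul_eq_zero.mp h1).resolve_right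
      (mul_ne_zero (mul_ne_zero (by norm_num) hPz) (hΦ z hz).1)
    obtain ⟨x, y, hxy⟩ := hAB
    have := congrArg (eval z) hxy
    simp [h0, hA0] at this
  set V := U ∩ {z | P.eval z ≠ 0} with hV
  have hVo : IsOpen V := hUo.inter (isOpen_eval_ne_zero P)
  have hu {z : ℂ} (hz : z ∈ V) :
      A₀.eval z / B₀.eval z = A.eval z / B.eval z + pCoeff k z / 2 := by
    have h1 := (hΦ z hz.1).1
    have h2 := hBz hz.1 hz.2
    have h3 : P.eval z ≠ 0 := hz.2
    rw [pCoeff_eq hk, ← hPdef]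
    field_simp
    linear_combination -hquot' z
  have hroot : ∀ z ∈ V, IsRoot (2 * P * (derivative A * B - A * derivative B + A ^ 2)
      + derivative P * A * B + 2 * numer (omega C) (shift C k ξ) * B ^ 2) z := by
    intro z hz
    have h2 := hBz hz.1 hz.2
    have h3 : P.eval z ≠ 0 := hz.2
    have hd := (hasDerivAt_eval_div A B h2).add ((hasDerivAt_pCoeff hk h3).div_const 2)
    have hd' : HasDerivAt (fun w => A₀.eval w / B₀.eval w) _ z :=
      hd.congr_of_eventuallyEq (Filter.eventuallyEq_of_mem (hVo.mem_nhds hz) fun w hw => hu hw)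
    have h4 := deriv_deriv_of_exp hUo (fun w hw => (hΦ w hw).2.1) (fun w hw => (hΦ w hw).2.2)
      hz.1 hd'
    rw [hode z hz.1] at h4
    have hW0 : W z ≠ 0 := by
      rw [(hΦ z hz.1).2.2]
      exact Complex.exp_ne_zero _
    have h5 := mul_right_cancel₀ hW0 h4
    rw [hu hz, rCoeff, qCoeff_eq hC] at h5
    have h6 : ((derivative A).eval z * B.eval z - A.eval z * (derivative B).eval z)
        / B.eval z ^ 2 + (A.eval z / B.eval z) ^ 2
        + (derivative P).eval z / (2 * P.eval z) * (A.eval z / B.eval z)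
        + (numer (omega C) (shift C k ξ)).eval z / P.eval z = 0 := by
      rw [← pCoeff_eq hk]
      linear_combination -h5
    simp only [IsRoot, eval_add, eval_mul, eval_sub, eval_pow, eval_ofNat]
    field_simp at h6
    linear_combination h6
  have hUinf : U.Infinite := infinite_of_mem_nhds z₀ (hUo.mem_nhds hz₀)
  apply eq_zero_of_infinite_isRoot
  refine (hUinf.sdiff (finite_setOfPred_isRoot hP0)).mono fun z hz => hroot z ⟨hz.1, hz.2⟩

/-- In the exceptional case `(z - 1/ω) P^{1/4}` is an exponential solution. -/
theorem isReducible_of_exceptional {C k ξ : ℝ} (hC : C ≠ 1) (hk : k ∈ Set.Ioo (0 : ℝ) 1)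
    (hm : shift C k ξ = 0) (hω : (2 * k ^ 2 - 1) * omega C ^ 2 = 2) :
    IsReducible (rCoeff C k ξ) := by
  have hω0 : (omega C : ℂ) ≠ 0 := by exact_mod_cast (omega_pos hC).ne'
  have hω' : (2 * (k : ℂ) ^ 2 - 1) * (omega C : ℂ) ^ 2 = 2 := by exact_mod_cast hω
  set P := quartic k with hPdef
  set c : ℂ := 1 / omega C with hc
  have hP0 : P ≠ 0 := quartic_ne_zero hk
  set B : ℂ[X] := 4 * P * (X - Polynomial.C c) with hBdef
  set A : ℂ[X] := 4 * P + derivative P * (X - Polynomial.C c) with hAdef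
  have hB0 : B ≠ 0 := mul_ne_zero (mul_ne_zero (by norm_num) hP0) (X_sub_C_ne_zero c)
  obtain ⟨z₀, hz₀⟩ : ∃ z, B.eval z ≠ 0 := by
    by_contra! hall
    exact hB0 (Polynomial.funext (by simpa using hall))
  obtain ⟨ε, hε, hball⟩ := Metric.isOpen_iff.mp (isOpen_eval_ne_zero B) z₀ hz₀
  have hBz {z : ℂ} (hz : z ∈ Metric.ball z₀ ε) : P.eval z ≠ 0 ∧ z - c ≠ 0 := by
    have : B.eval z ≠ 0 := hball hz
    simp only [hBdef, eval_mul, eval_sub, eval_X, eval_C, eval_ofNat] at this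
    exact ⟨right_ne_zero_of_mul (left_ne_zero_of_mul this), right_ne_zero_of_mul this⟩
  obtain ⟨Φ, hΦ⟩ : Complex.IsExactOn (fun z => A.eval z / B.eval z) (Metric.ball z₀ ε) :=
    DifferentiableOn.isExactOn_ball fun z hz =>
      (hasDerivAt_eval_div A B (hball hz)).differentiableAt.differentiableWithinAt
  have hu {z : ℂ} (hz : z ∈ Metric.ball z₀ ε) :
      A.eval z / B.eval z = 1 / (z - c) + pCoeff k z / 2 := by
    obtain ⟨h1, h2⟩ := hBz hz
    rw [pCoeff_eq hk, ← hPdef]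
    simp only [hAdef, hBdef, eval_add, eval_mul, eval_sub, eval_X, eval_C, eval_ofNat]
    field_simp
    ring
  have hpd : DifferentiableOn ℂ (pCoeff k) (Metric.ball z₀ ε) := fun z hz =>
    (hasDerivAt_pCoeff hk (hBz hz).1).differentiableAt.differentiableWithinAt
  refine ⟨Metric.ball z₀ ε, fun z => Complex.exp (Φ z), Metric.isOpen_ball,
    Metric.isConnected_ball hε, ?_, ?_, A, B, Φ,
    fun z hz => ⟨hball hz, hΦ z hz, rfl⟩⟩
  · have hqd : DifferentiableOn ℂ (qCoeff C k ξ) (Metric.ball z₀ ε) := by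
      rw [funext (qCoeff_eq hC k ξ)]
      exact fun z hz =>
        (hasDerivAt_eval_div _ _ (hBz hz).1).differentiableAt.differentiableWithinAt
    exact (hqd.neg.add ((hpd.deriv Metric.isOpen_ball).const_mul _)).add
      ((hpd.pow 2).const_mul _)
  · intro z hz
    obtain ⟨h1, h2⟩ := hBz hz
    have hd : HasDerivAt (fun w => 1 / (w - c) + pCoeff k w / 2)
        (-1 / (z - c) ^ 2 + deriv (pCoeff k) z / 2) z := by
      have := ((hasDerivAt_id z).sub_const c).fun_inv h2
      simpa [one_div] using this.fun_add ((hasDerivAt_pCoeff hk h1).div_const 2)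
    have hd' : HasDerivAt (fun w => A.eval w / B.eval w) _ z := hd.congr_of_eventuallyEq
      (Filter.eventuallyEq_of_mem (Metric.isOpen_ball.mem_nhds hz) fun w hw => hu hw)
    rw [deriv_deriv_of_exp Metric.isOpen_ball hΦ (fun w _ => rfl) hz hd', hu hz, rCoeff,
      qCoeff_eq hC, hm]
    congr 1
    -- `P' / 2 = -(z - 1/ω) N`
    have hPN : z * (-1 + 2 * ((k : ℂ) ^ 2 - z ^ 2))
        = -((z - c) * (2 * z ^ 2 + 2 / omega C * z)) := by
      have hk2 : 2 * (k : ℂ) ^ 2 - 1 = 2 / (omega C : ℂ) ^ 2 := by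
        rw [eq_div_iff (pow_ne_zero 2 hω0), hω']
      rw [hc]
      linear_combination z * hk2
    have hpq : pCoeff k z / (z - c)
        = -((numer (omega C) 0).eval z / (quartic k).eval z) := by
      rw [pCoeff_eq hk, eval_derivative_quartic hk, hPN, eval_numer, ← hPdef]
      push_cast
      field_simp
      ring
    rw [← sub_eq_zero]
    have e : (-1 / (z - c) ^ 2 + (1 / (z - c)) ^ 2) = 0 := by
      field_simp
      ring
    linear_combination e + hpq

end SymmetricSatellite

open SymmetricSatellite Polynomial in
theorem mainTheorem5 (C k ξ : ℝ) (hC : C ≠ 1) (hk : k ∈ Set.Ioo (0 : ℝ) 1) :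
    SymmetricSatellite.IsReducible (SymmetricSatellite.rCoeff C k ξ) ↔
      (ξ = 3 / 2 * (1 - C) ∧ SymmetricSatellite.omega C ^ 2 = 2 / (2 * k ^ 2 - 1)) := by
  rw [exceptional_iff ξ hC hk]
  refine ⟨fun h => ?_, fun h => isReducible_of_exceptional hC hk h.1 h.2⟩
  obtain ⟨A, B, hAB, hB, hR⟩ := exists_riccati_of_isReducible hC hk h
  have hP := natDegree_quartic_le k
  have hN := natDegree_numer_le (omega C) (shift C k ξ)
  have hω := omega_pos hC
  obtain ⟨d, s, hs, rfl, hA⟩ := exists_finset_of_riccati hR hAB hB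
    (natDegree_lt_of_riccati hR hP (coeff_quartic k) hN hB.ne_zero) (quartic_roots_simple hk)
  rcases card_of_riccati hR hP (coeff_quartic k) hN (coeff_numer _ _) hA with
    ⟨hd1, hs0⟩ | ⟨hd0, hs2⟩
  · obtain ⟨a, rfl⟩ := Finset.card_eq_one.mp hd1
    obtain rfl := Finset.card_eq_zero.mp hs0
    have hA1 : A = 1 := by
      simp only [rootPoly, Finset.prod_singleton, Finset.prod_empty, derivative_sub, derivative_X,
        derivative_C, derivative_one] at hA
      have : (2 : ℂ[X]) * (A - 1) = 0 := by linear_combination hA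
      exact sub_eq_zero.mp ((mul_eq_zero.mp this).resolve_left two_ne_zero)
    rw [hA1] at hR
    simp only [rootPoly, Finset.prod_singleton, Finset.prod_empty, mul_one] at hR
    exact params_of_linear hω.ne' hk hR
  · obtain rfl := Finset.card_eq_zero.mp hd0
    obtain ⟨a, b, hab, rfl⟩ := Finset.card_eq_two.mp hs2
    have hA2 : 2 * A = X - Polynomial.C a + (X - Polynomial.C b) := by
      simp only [rootPoly, Finset.prod_pair hab, Finset.prod_empty, derivative_mul, derivative_sub,
        derivative_X, derivative_C, derivative_one] at hA
      linear_combination hA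
    simp only [rootPoly, Finset.prod_pair hab, Finset.prod_empty, one_mul] at hR
    have hsum := sum_of_quadratic hk hA2 hR
    refine absurd ?_ (sum_roots_ne hk (t := 2 / omega C) (by positivity) hab
      (hs a (by simp)) (hs b (by simp)))
    rw [hsum]
    push_cast
    rfl
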